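/- Let $\mathcal{A}$ be a finite set of actions with $|\mathcal{A}|\ge 2$ and let $\mathcal{V}$ be a countably infinite set of variables. The terms of $\mathrm{BCCSP}_{\|}$ are given by the grammar \[ t ::= \mathbf{0} \mid x \mid a.t \mid t+t \mid t \mathbin{\|} t \qquad (a\in\mathcal{A},\ x\in\mathcal{V}), \] and processes are the closed terms, i.e. the terms without variables. The transitions $p\xrightarrow{a}p'$ between processes are those derivable from the rules: $a.p\xrightarrow{a}p$; if $p\xrightarrow{a}p'$ then $p+q\xrightarrow{a}p'$, $q+p\xrightarrow{a}p'$, $p\mathbin{\|}q\xrightarrow{a}p'\mathbin{\|}q$ and $q\mathbin{\|}p\xrightarrow{a}q\mathbin{\|}p'$. For $\alpha=a_1\cdots a_k\in\mathcal{A}^*$, write $p\xrightarrow{\alpha}p'$ if $p=p_0\xrightarrow{a_1}p_1\xrightarrow{a_2}\cdots\xrightarrow{a_k}p_k=p'$ for some processes $p_0,\dots,p_k$, and let $\mathtt{T}(p)=\{\alpha\mid p\xrightarrow{\alpha}p'\text{ for some }p'\}$. Two processes $p,q$ are possible futures equivalent, $p\sim_{\mathtt{PF}}q$, if $\mathtt{PF}(p)=\mathtt{PF}(q)$,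 where $\mathtt{PF}(p)=\{(\alpha,\mathtt{T}(p'))\mid p\xrightarrow{\alpha}p'\}$. They are bisimilar, $p\sim_{\mathtt{B}}q$, if $p\,S\,q$ for some symmetric relation $S$ on processes such that whenever $r\,S\,s$ and $r\xrightarrow{a}r'$ there is $s'$ with $s\xrightarrow{a}s'$ and $r'\,S\,s'$. A congruence is an equivalence relation on processes that is preserved by prefixing $a.\_$ (for every $a \in \mathcal{A}$), $+$ and $\|$. An axiom system $\mathcal{E}$ is a set of equations $t\approx u$ between terms; $\mathcal{E}\vdash t\approx u$ means that $t\approx u$ can be derived from $\mathcal{E}$ by the rules of equational logic (reflexivity, symmetry, transitivity, substitution, and closure under the operators). For a relation $\mathcal{R}$ on processes, $\mathcal{E}$ is sound modulo $\mathcal{R}$ if $\sigma(t)\,\mathcal{R}\,\sigma(u)$ for every equation $t\approx u$ in $\mathcal{E}$ and every substitution $\sigma$ of closed terms for the variables; it is ground-complete modulo $\mathcal{R}$ if $\mathcal{E}\vdash p\approx q$ for all processes $p,q$ with $p\,\mathcal{R}\,q$. We say that $\mathcal{R}$ has a finite, ground-complete axiomatisation if some finite axiom system is both sound and ground-complete modulo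 $\mathcal{R}$. **Theorem.** Let $\mathcal{R}$ be a congruence with ${\sim_{\mathtt{B}}}\subseteq\mathcal{R}\subseteq{\sim_{\mathtt{PF}}}$. Then $\mathcal{R}$ has no finite, ground-complete equational axiomatisation over $\mathrm{BCCSP}_{\|}$. -/

import Mathlib

namespace BCCSPPar

universe u v

/-- Terms `t ::= 0 | x | a.t | t + t | t ∥ t`, with actions from `A` and variables from `V`. -/
inductive Term (A : Type u) (V : Type v) : Type (max u v) where
  | nil : Term A V
  | var (x : V) : Term A V
  | act (a : A) (t : Term A V) : Term A V
  | choice (t s : Term A V) : Term A V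
  | par (t s : Term A V) : Term A V

namespace Term

variable {A : Type u} {V : Type v}

/-- The set of variables that occur in a term. -/
def vars : Term A V → Set V
  | nil => ∅
  | var x => {x}
  | act _ t => t.vars
  | choice t s => t.vars ∪ s.vars
  | par t s => t.vars ∪ s.vars

/-- A term is closed if no variable occurs in it. -/
def Closed (t : Term A V) : Prop := t.vars = ∅

/-- Application of a substitution to a term. -/
def subst (σ : V → Term A V) : Term A V → Term A V
  | nil => nil
  | var x => σ x
  | act a t => act a (t.subst σ)
  | choice t s => choice (t.subst σ) (s.subst σ)
  | par t s => par (t.subst σ) (s.subst σ)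

/-- The literals `t --a--> t'` derivable with the rules of the structural operational semantics. -/
inductive Step : Term A V → A → Term A V → Prop where
  | act (a : A) (t : Term A V) : Step (act a t) a t
  | choice_left {t s t' : Term A V} {a : A} : Step t a t' → Step (choice t s) a t'
  | choice_right {t s s' : Term A V} {a : A} : Step s a s' → Step (choice t s) a s'
  | par_left {t s t' : Term A V} {a : A} : Step t a t' → Step (par t s) a (par t' s)
  | par_right {t s s' : Term A V} {a : A} : Step s a s' → Step (par t s) a (par t s')

theorem closed_nil : Closed (nil : Term A V) := rfl

theorem Closed.act {t : Term A V} (a : A) (ht : t.Closed) : (act a t).Closed := ht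

theorem Closed.choice {t s : Term A V} (ht : t.Closed) (hs : s.Closed) : (choice t s).Closed :=
  Set.union_empty_iff.2 ⟨ht, hs⟩

theorem Closed.par {t s : Term A V} (ht : t.Closed) (hs : s.Closed) : (par t s).Closed :=
  Set.union_empty_iff.2 ⟨ht, hs⟩

theorem closed_subst {σ : V → Term A V} (hσ : ∀ x, (σ x).Closed) (t : Term A V) :
    (t.subst σ).Closed := by
  induction t with
  | nil => exact closed_nil
  | var x => exact hσ x
  | act a t ih => exact ih.act a
  | choice t s iht ihs => exact iht.choice ihs
  | par t s iht ihs => exact iht.par ihs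

end Term

/-- Processes are the closed terms. -/
abbrev Proc (A : Type u) (V : Type v) : Type (max u v) := {t : Term A V // t.Closed}

namespace Proc

variable {A : Type u} {V : Type v}

/-- Prefixing of processes. -/
def act (a : A) (p : Proc A V) : Proc A V := ⟨Term.act a p.1, p.2.act a⟩

/-- Nondeterministic choice of processes. -/
def choice (p q : Proc A V) : Proc A V := ⟨Term.choice p.1 q.1, p.2.choice q.2⟩

/-- Interleaving parallel composition of processes. -/
def par (p q : Proc A V) : Proc A V := ⟨Term.par p.1 q.1, p.2.par q.2⟩

/-- The transition relation of the labelled transition system of processes. -/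
def Step (p : Proc A V) (a : A) (q : Proc A V) : Prop := Term.Step p.1 a q.1

/-- `p.Steps α q`: there is a sequence of transitions from `p` to `q` that is labelled by `α`. -/
def Steps (p : Proc A V) : List A → Proc A V → Prop
  | [], q => p = q
  | a :: α, q => ∃ r : Proc A V, p.Step a r ∧ r.Steps α q

/-- The set of traces of a process. -/
def traces (p : Proc A V) : Set (List A) := {α | ∃ q, p.Steps α q}

/-- The set of possible futures of a process. -/
def possibleFutures (p : Proc A V) : Set (List A × Set (List A)) :=
  {f | ∃ q, p.Steps f.1 q ∧ f.2 = q.traces}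

/-- Possible futures equivalence. -/
def PFEquiv (p q : Proc A V) : Prop := p.possibleFutures = q.possibleFutures

/-- Simulations. -/
def IsSimulation (S : Proc A V → Proc A V → Prop) : Prop :=
  ∀ p q, S p q → ∀ a p', p.Step a p' → ∃ q', q.Step a q' ∧ S p' q'

/-- Bisimilarity: two processes are bisimilar if some symmetric simulation relates them. -/
def Bisimilar (p q : Proc A V) : Prop :=
  ∃ S : Proc A V → Proc A V → Prop, (∀ p q, S p q → S q p) ∧ IsSimulation S ∧ S p q

/-- Congruences: equivalence relations on processes preserved by all operators of the language. -/
structure IsCongruence (R : Proc A V → Proc A V → Prop) : Prop where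
  equivalence : Equivalence R
  act : ∀ (a : A) {p q}, R p q → R (act a p) (act a q)
  choice : ∀ {p q p' q'}, R p q → R p' q' → R (choice p p') (choice q q')
  par : ∀ {p q p' q'}, R p q → R p' q' → R (par p p') (par q q')

end Proc

section EquationalLogic

variable {A : Type u} {V : Type v}

/-- An axiom system is a set of equations; the pair `(t, s)` stands for the equation `t ≈ s`. -/
abbrev AxiomSystem (A : Type u) (V : Type v) : Type (max u v) := Set (Term A V × Term A V)

/-- `Derivable E t s`: the equation `t ≈ s` has an equational proof from `E`. -/
inductive Derivable (E : AxiomSystem A V) : Term A V → Term A V → Prop where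
  | ax {t s : Term A V} : (t, s) ∈ E → Derivable E t s
  | refl (t : Term A V) : Derivable E t t
  | symm {t s : Term A V} : Derivable E t s → Derivable E s t
  | trans {t s r : Term A V} : Derivable E t s → Derivable E s r → Derivable E t r
  | subst (σ : V → Term A V) {t s : Term A V} :
      Derivable E t s → Derivable E (t.subst σ) (s.subst σ)
  | act (a : A) {t s : Term A V} : Derivable E t s → Derivable E (Term.act a t) (Term.act a s)
  | choice {t s t' s' : Term A V} : Derivable E t s → Derivable E t' s' →
      Derivable E (Term.choice t t') (Term.choice s s')
  | par {t s t' s' : Term A V} : Derivable E t s → Derivable E t' s' →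
      Derivable E (Term.par t t') (Term.par s s')

/-- The equation `t ≈ s` is sound modulo `R` if all its closed instances are in `R`. -/
def SoundEquation (R : Proc A V → Proc A V → Prop) (t s : Term A V) : Prop :=
  ∀ (σ : V → Term A V) (hσ : ∀ x, (σ x).Closed),
    R ⟨t.subst σ, Term.closed_subst hσ t⟩ ⟨s.subst σ, Term.closed_subst hσ s⟩

/-- An axiom system is sound modulo `R` if all its equations are. -/
def Sound (R : Proc A V → Proc A V → Prop) (E : AxiomSystem A V) : Prop :=
  ∀ t s, (t, s) ∈ E → SoundEquation R t s

/-- An axiom system is ground-complete modulo `R` if it proves all `R`-related closed terms equal. -/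
def GroundComplete (R : Proc A V → Proc A V → Prop) (E : AxiomSystem A V) : Prop :=
  ∀ p q : Proc A V, R p q → Derivable E p.1 q.1

/-- `R` has a finite ground-complete axiomatisation. -/
def HasFiniteGroundCompleteAxiomatisation (R : Proc A V → Proc A V → Prop) : Prop :=
  ∃ E : AxiomSystem A V, E.Finite ∧ Sound R E ∧ GroundComplete R E

end EquationalLogic

end BCCSPPar

/-!
Let `a ≠ b` and `p_N = ∑ baⁱb`, for `1 ≤ i ≤ N`. The process `a ∥ p_N` (`target`) has the same
transitions as its expansion `a(0 ∥ p_N) + ∑ b(a ∥ aⁱb)` (`expandedTarget`), so the two are related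
by `R`. No finite sound axiom system derives all these equations, because of the following
invariant. Call a term *good* (`Good`) if one of its summands is a parallel composition of a term
with the traces of `a` and a term with the traces of `p_N`; summands are taken syntactically, looking
through components of `∥` that have no transitions. The process `a ∥ p_N` is good and its expansion,
a sum of prefixes, is not.

Let `N` exceed the number of prefixes in each term of the axioms. Goodness is then preserved by
derivations as long as the terms are *below* `a ∥ p_N` (`Below`): their transitions are matched by
those of `a ∥ p_N` up to trace equivalence of the targets. All of this is read off from possible
futures along traces of length at most one, so it makes sense for each `R` inside possible futures
equivalence. Only the instances `σ(t) ≈ σ(u)` of axioms need an argument (`SoundEquation.good`).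

If `σ(t)` is good, then either `σ(x)` is good for a variable `x` of `t`, or `t` has a summand
`t₁ ∥ t₂` with the traces of `a` and of `p_N` under `σ` (`Good.exists_probes`). In the first case `x`
occurs in `u` by soundness, and since `σ(x)` is as deep as `a ∥ p_N`, it can only occur as a summand
(`Good.subst_of_mem_vars`). In the second case `t₂` has too few prefixes to provide all `N` branches
`baⁱb`, so it has a variable `x` as a summand such that `σ(x)` performs `b` twice. Replacing `σ(x)` by
`bⁿ⁺¹` for a large `n` gives `t` a `b`-transition to a process of depth `n + 1`, by way of
`t₁ ∥ bⁿ⁺¹`. The right-hand side `u` can match it only with a summand `v ∥ w` where `x` occurs in `v`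
and `w` is not inert (`good_of_step_probe`). Since `a ∥ p_N` performs `b` at most twice, `σ(w)` performs
only `a`, and the future of `a ∥ p_N` along `a` forces `σ(w)` to have the traces of `a` and `σ(v)`
those of `p_N` (`tr_eq_of_below_par`). So `σ(u)` is good.

The words `baⁱb` are used since none is a prefix of another, so that a trace set containing them
determines every branch.
-/

namespace BCCSPPar

universe u v

namespace Term

variable {A : Type u} {V : Type v}

/-! ### Transitions, traces and weights of terms -/

@[simp] theorem step_nil_iff {c : A} {r : Term A V} : Step nil c r ↔ False :=
  ⟨fun h => (nomatch h), False.elim⟩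

@[simp] theorem step_act_iff {c d : A} {t r : Term A V} : Step (act d t) c r ↔ c = d ∧ r = t := by
  constructor
  · intro h; cases h; exact ⟨rfl, rfl⟩
  · rintro ⟨rfl, rfl⟩; exact .act _ _

@[simp] theorem step_choice_iff {c : A} {t s r : Term A V} :
    Step (choice t s) c r ↔ Step t c r ∨ Step s c r := by
  constructor
  · intro h
    cases h with
    | choice_left h => exact .inl h
    | choice_right h => exact .inr h
  · rintro (h | h)
    · exact .choice_left h
    · exact .choice_right h

theorem step_par_iff {c : A} {t s r : Term A V} :
    Step (par t s) c r ↔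
      (∃ t', Step t c t' ∧ r = par t' s) ∨ (∃ s', Step s c s' ∧ r = par t s') := by
  constructor
  · intro h
    cases h with
    | par_left h => exact .inl ⟨_, h, rfl⟩
    | par_right h => exact .inr ⟨_, h, rfl⟩
  · rintro (⟨t', h, rfl⟩ | ⟨s', h, rfl⟩)
    · exact .par_left h
    · exact .par_right h

theorem Step.closed {t r : Term A V} {c : A} (h : Step t c r) (ht : t.Closed) : r.Closed := by
  induction h with
  | act a t => exact ht
  | choice_left _ ih => exact ih (Set.union_empty_iff.1 ht).1
  | choice_right _ ih => exact ih (Set.union_empty_iff.1 ht).2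
  | par_left _ ih =>
    exact (ih (Set.union_empty_iff.1 ht).1).par (Set.union_empty_iff.1 ht).2
  | par_right _ ih =>
    exact Closed.par (Set.union_empty_iff.1 ht).1 (ih (Set.union_empty_iff.1 ht).2)

theorem Closed.subst_eq {t : Term A V} (ht : t.Closed) (σ : V → Term A V) : t.subst σ = t := by
  induction t with
  | nil => rfl
  | var x => exact (Set.singleton_ne_empty x ht).elim
  | act a t ih => exact congrArg _ (ih ht)
  | choice t s iht ihs =>
    exact congrArg₂ _ (iht (Set.union_empty_iff.1 ht).1) (ihs (Set.union_empty_iff.1 ht).2)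
  | par t s iht ihs =>
    exact congrArg₂ _ (iht (Set.union_empty_iff.1 ht).1) (ihs (Set.union_empty_iff.1 ht).2)

theorem subst_subst (σ τ : V → Term A V) (t : Term A V) :
    (t.subst τ).subst σ = t.subst fun x => (τ x).subst σ := by
  induction t with
  | nil => rfl
  | var x => rfl
  | act a t ih => simp [subst, ih]
  | choice t s iht ihs => simp [subst, iht, ihs]
  | par t s iht ihs => simp [subst, iht, ihs]

theorem subst_update_of_notMem [DecidableEq V] (σ : V → Term A V) {x : V} (p : Term A V)
    {t : Term A V} (hx : x ∉ t.vars) : t.subst (Function.update σ x p) = t.subst σ := by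
  induction t with
  | nil => rfl
  | var y => exact Function.update_of_ne (fun h => hx (by simp [vars, h])) _ _
  | act a t ih => simp only [subst, ih hx]
  | choice t s iht ihs =>
    simp only [vars, Set.mem_union, not_or] at hx
    simp only [subst, iht hx.1, ihs hx.2]
  | par t s iht ihs =>
    simp only [vars, Set.mem_union, not_or] at hx
    simp only [subst, iht hx.1, ihs hx.2]

/-- `α` labels a sequence of transitions from `t`. Variables count as inert processes, so this
makes sense for open terms as well. -/
def IsTrace (t : Term A V) : List A → Prop
  | [] => True
  | c :: α => ∃ t', Step t c t' ∧ IsTrace t' α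

/-- The trace set of a term. -/
def tr (t : Term A V) : Set (List A) := {α | IsTrace t α}

theorem isTrace_singleton {t r : Term A V} {c : A} (h : Step t c r) : IsTrace t [c] :=
  ⟨r, h, trivial⟩

theorem isTrace_congr {t s : Term A V} (h : tr t = tr s) (α : List A) :
    IsTrace t α ↔ IsTrace s α := Set.ext_iff.1 h α

theorem IsTrace.par_append_singleton {p p' q : Term A V} {c : A} (hp : Step p c p') {α : List A}
    (h : IsTrace q α) : IsTrace (par p q) (α ++ [c]) := by
  induction α generalizing q with
  | nil => exact ⟨_, .par_left hp, trivial⟩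
  | cons d α ih =>
    obtain ⟨q', hq, h'⟩ := h
    exact ⟨_, .par_right hq, ih h'⟩

/-- The largest total weight of a trace of the term, when each action `c` weighs `f c`. -/
def weight (f : A → ℕ) : Term A V → ℕ
  | nil => 0
  | var _ => 0
  | act c t => f c + t.weight f
  | choice t s => max (t.weight f) (s.weight f)
  | par t s => t.weight f + s.weight f

/-- The length of a longest trace; a term has depth `0` exactly if it has no transitions. -/
abbrev depth (t : Term A V) : ℕ := t.weight fun _ => 1

/-- The largest number of occurrences of `b` in a trace of the term. -/
abbrev countAct [DecidableEq A] (b : A) (t : Term A V) : ℕ :=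
  t.weight fun c => if c = b then 1 else 0

theorem Step.weight_le (f : A → ℕ) {t r : Term A V} {c : A} (h : Step t c r) :
    f c + r.weight f ≤ t.weight f := by
  induction h with
  | act a t => simp [weight]
  | choice_left _ ih => simp only [weight]; omega
  | choice_right _ ih => simp only [weight]; omega
  | par_left _ ih => simp only [weight]; omega
  | par_right _ ih => simp only [weight]; omega

theorem IsTrace.sum_le (f : A → ℕ) {t : Term A V} {α : List A} (h : IsTrace t α) :
    (α.map f).sum ≤ t.weight f := by
  induction α generalizing t with
  | nil => simp
  | cons c α ih =>
    obtain ⟨r, hr, h'⟩ := h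
    have := hr.weight_le f
    have := ih h'
    simp only [List.map_cons, List.sum_cons]
    omega

theorem IsTrace.par {t s : Term A V} {α β : List A} (ht : IsTrace t α) (hs : IsTrace s β) :
    IsTrace (par t s) (α ++ β) := by
  induction α generalizing t with
  | nil =>
    induction β generalizing s with
    | nil => trivial
    | cons c β ih =>
      obtain ⟨s', h, h'⟩ := hs
      exact ⟨_, .par_right h, ih h'⟩
  | cons c α ih =>
    obtain ⟨t', h, h'⟩ := ht
    exact ⟨_, .par_left h, ih h'⟩

theorem IsTrace.choice_left {t s : Term A V} {α : List A} (h : IsTrace t α) :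
    IsTrace (choice t s) α := by
  cases α with
  | nil => trivial
  | cons c α =>
    obtain ⟨r, hr, h'⟩ := h
    exact ⟨r, .choice_left hr, h'⟩

theorem IsTrace.choice_right {t s : Term A V} {α : List A} (h : IsTrace s α) :
    IsTrace (choice t s) α := by
  cases α with
  | nil => trivial
  | cons c α =>
    obtain ⟨r, hr, h'⟩ := h
    exact ⟨r, .choice_right hr, h'⟩

theorem exists_isTrace_sum_eq (f : A → ℕ) (t : Term A V) :
    ∃ α, IsTrace t α ∧ (α.map f).sum = t.weight f := by
  induction t with
  | nil => exact ⟨[], trivial, rfl⟩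
  | var x => exact ⟨[], trivial, rfl⟩
  | act a t ih =>
    obtain ⟨α, h, h'⟩ := ih
    exact ⟨a :: α, ⟨t, .act a t, h⟩, by simp [weight, h']⟩
  | choice t s iht ihs =>
    obtain ⟨α, h, h'⟩ := iht
    obtain ⟨β, k, k'⟩ := ihs
    rcases le_total (t.weight f) (s.weight f) with hle | hle
    · exact ⟨β, k.choice_right, by simp [weight, k', hle]⟩
    · exact ⟨α, h.choice_left, by simp [weight, h', hle]⟩
  | par t s iht ihs =>
    obtain ⟨α, h, h'⟩ := iht
    obtain ⟨β, k, k'⟩ := ihs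
    exact ⟨α ++ β, h.par k, by simp [weight, h', k']⟩

theorem weight_le_of_tr_subset (f : A → ℕ) {t s : Term A V} (h : tr t ⊆ tr s) :
    t.weight f ≤ s.weight f := by
  obtain ⟨α, hα, hw⟩ := exists_isTrace_sum_eq f t
  exact hw ▸ IsTrace.sum_le f (h hα)

theorem weight_eq_of_tr_eq (f : A → ℕ) {t s : Term A V} (h : tr t = tr s) :
    t.weight f = s.weight f :=
  le_antisymm (weight_le_of_tr_subset f h.le) (weight_le_of_tr_subset f h.ge)

theorem weight_le_of_mem_vars (f : A → ℕ) (σ : V → Term A V) {x : V} {t : Term A V}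
    (hx : x ∈ t.vars) : (σ x).weight f ≤ (t.subst σ).weight f := by
  induction t with
  | nil => exact hx.elim
  | var y => obtain rfl : x = y := hx; exact le_rfl
  | act a t ih => have := ih hx; simp only [subst, weight]; omega
  | choice t s iht ihs =>
    simp only [subst, weight]
    rcases hx with hx | hx
    · have := iht hx; omega
    · have := ihs hx; omega
  | par t s iht ihs =>
    simp only [subst, weight]
    rcases hx with hx | hx
    · have := iht hx; omega
    · have := ihs hx; omega

theorem Step.depth_pos {t r : Term A V} {c : A} (h : Step t c r) : 0 < t.depth := by
  have := h.weight_le fun _ => 1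
  simp only [depth]; omega

theorem exists_step_of_depth_pos {t : Term A V} (h : 0 < t.depth) : ∃ c r, Step t c r := by
  obtain ⟨α, hα, hw⟩ := exists_isTrace_sum_eq (fun _ => 1) t
  cases α with
  | nil => simp only [depth, ← hw] at h; simp at h
  | cons c α => obtain ⟨r, hr, -⟩ := hα; exact ⟨c, r, hr⟩

theorem depth_eq_zero_iff {t : Term A V} : t.depth = 0 ↔ ∀ c r, ¬ Step t c r := by
  constructor
  · intro h c r hs; have := hs.depth_pos; omega
  · intro h
    by_contra h0
    obtain ⟨c, r, hr⟩ := exists_step_of_depth_pos (Nat.pos_of_ne_zero h0)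
    exact h c r hr

theorem countAct_le_depth [DecidableEq A] (b : A) (t : Term A V) : t.countAct b ≤ t.depth := by
  induction t with
  | nil => exact le_rfl
  | var x => exact le_rfl
  | act a t ih => simp only [countAct, depth, weight] at *; split_ifs <;> omega
  | choice t s iht ihs => simp only [countAct, depth, weight] at *; omega
  | par t s iht ihs => simp only [countAct, depth, weight] at *; omega

theorem Step.countAct_pos [DecidableEq A] {b : A} {t r : Term A V} (h : Step t b r) :
    0 < t.countAct b := by
  have := h.weight_le fun c => if c = b then 1 else 0
  simp only [countAct, if_true] at *; omega

theorem tr_par_of_depth_right {p q : Term A V} (hq : q.depth = 0) : tr (par p q) = tr p := by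
  ext α
  change IsTrace _ _ ↔ IsTrace _ _
  induction α generalizing p with
  | nil => exact Iff.rfl
  | cons c α ih =>
    constructor
    · rintro ⟨r, hr, h⟩
      rcases step_par_iff.1 hr with ⟨p', hp, rfl⟩ | ⟨q', hq', -⟩
      · exact ⟨p', hp, ih.1 h⟩
      · exact (depth_eq_zero_iff.1 hq _ _ hq').elim
    · rintro ⟨p', hp, h⟩
      exact ⟨_, .par_left hp, ih.2 h⟩

theorem tr_par_comm (p q : Term A V) : tr (par p q) = tr (par q p) := by
  have key : ∀ (α : List A) (p q : Term A V), IsTrace (par p q) α → IsTrace (par q p) α := by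
    intro α
    induction α with
    | nil => intros; trivial
    | cons c α ih =>
      rintro p q ⟨r, hr, h⟩
      rcases step_par_iff.1 hr with ⟨p', hp, rfl⟩ | ⟨q', hq, rfl⟩
      · exact ⟨_, .par_right hp, ih _ _ h⟩
      · exact ⟨_, .par_left hq, ih _ _ h⟩
  exact Set.ext fun α => ⟨key α p q, key α q p⟩

theorem tr_par_of_depth_left {p q : Term A V} (hp : p.depth = 0) : tr (par p q) = tr q := by
  rw [tr_par_comm, tr_par_of_depth_right hp]

/-- Every transition of `p` is matched by one of `P` with the same label that ends in a trace
equivalent term. This is the inclusion of the possible futures along traces of length one; it is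
inherited by summands, and by a component of a parallel composition if the other one is inert. -/
def Below (P p : Term A V) : Prop :=
  ∀ c p', Step p c p' → ∃ r, Step P c r ∧ tr p' = tr r

theorem Below.refl (P : Term A V) : Below P P := fun _ r h => ⟨r, h, rfl⟩

theorem Below.trans {P p q : Term A V} (h : Below P p) (h' : Below p q) : Below P q := by
  intro c q' hq
  obtain ⟨p', hp, e⟩ := h' c q' hq
  obtain ⟨r, hr, e'⟩ := h c p' hp
  exact ⟨r, hr, e.trans e'⟩

theorem Below.of_choice {P p q : Term A V} (h : Below P (choice p q)) : Below P p ∧ Below P q :=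
  ⟨fun c p' hp => h c p' (.choice_left hp), fun c q' hq => h c q' (.choice_right hq)⟩

theorem Below.of_par_left {P p q : Term A V} (h : Below P (par p q)) (hq : q.depth = 0) :
    Below P p := by
  intro c p' hp
  obtain ⟨r, hr, e⟩ := h c _ (.par_left hp)
  exact ⟨r, hr, (tr_par_of_depth_right hq).symm.trans e⟩

theorem Below.of_par_right {P p q : Term A V} (h : Below P (par p q)) (hp : p.depth = 0) :
    Below P q := by
  intro c q' hq
  obtain ⟨r, hr, e⟩ := h c _ (.par_right hq)
  exact ⟨r, hr, (tr_par_of_depth_left hp).symm.trans e⟩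

theorem Below.par_comm {P p q : Term A V} (h : Below P (par p q)) : Below P (par q p) := by
  intro c s hs
  rcases step_par_iff.1 hs with ⟨q', hq, rfl⟩ | ⟨p', hp, rfl⟩
  · rw [tr_par_comm]; exact h c _ (.par_right hq)
  · rw [tr_par_comm]; exact h c _ (.par_left hp)

theorem Below.weight_le (f : A → ℕ) {P p : Term A V} (h : Below P p) :
    p.weight f ≤ P.weight f := by
  refine weight_le_of_tr_subset f fun α hα => ?_
  cases α with
  | nil => trivial
  | cons c α =>
    obtain ⟨p', hp, h'⟩ := hα
    obtain ⟨r, hr, e⟩ := h c p' hp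
    exact ⟨r, hr, (isTrace_congr e α).1 h'⟩

/-! ### The family of processes -/

section Family

variable (a b : A)

/-- The process `aⁱb`. -/
def word : ℕ → Term A V
  | 0 => act b nil
  | i + 1 => act a (word i)

/-- The process `∑ baⁱb`, for `1 ≤ i ≤ N`. -/
def branches : ℕ → Term A V
  | 0 => nil
  | n + 1 => choice (branches n) (act b (word a b (n + 1)))

/-- The process `a ∥ ∑ baⁱb`, for `1 ≤ i ≤ N`. -/
def target (N : ℕ) : Term A V := par (act a nil) (branches a b N)

/-- The process `∑ b(a ∥ aⁱb)`, for `1 ≤ i ≤ N`. -/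
def expandedBranches : ℕ → Term A V
  | 0 => nil
  | n + 1 => choice (expandedBranches n) (act b (par (act a nil) (word a b (n + 1))))

/-- The expansion `a(0 ∥ ∑ baⁱb) + ∑ b(a ∥ aⁱb)` of `a ∥ ∑ baⁱb`, for `1 ≤ i ≤ N`. -/
def expandedTarget (N : ℕ) : Term A V :=
  choice (act a (par nil (branches a b N))) (expandedBranches a b N)

end Family

variable {a b : A}

theorem step_branches_iff {N : ℕ} {c : A} {r : Term A V} :
    Step (branches a b N) c r ↔ c = b ∧ ∃ i < N, r = word a b (i + 1) := by
  induction N with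
  | zero => simp [branches]
  | succ n ih =>
    simp only [branches, step_choice_iff, ih, step_act_iff, Nat.lt_succ_iff_lt_or_eq]
    constructor
    · rintro (⟨rfl, i, hi, rfl⟩ | ⟨rfl, rfl⟩)
      · exact ⟨rfl, i, .inl hi, rfl⟩
      · exact ⟨rfl, n, .inr rfl, rfl⟩
    · rintro ⟨rfl, i, hi | rfl, rfl⟩
      · exact .inl ⟨rfl, i, hi, rfl⟩
      · exact .inr ⟨rfl, rfl⟩

theorem step_expandedBranches_iff {N : ℕ} {c : A} {r : Term A V} :
    Step (expandedBranches a b N) c r ↔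
      c = b ∧ ∃ i < N, r = par (act a nil) (word a b (i + 1)) := by
  induction N with
  | zero => simp [expandedBranches]
  | succ n ih =>
    simp only [expandedBranches, step_choice_iff, ih, step_act_iff, Nat.lt_succ_iff_lt_or_eq]
    constructor
    · rintro (⟨rfl, i, hi, rfl⟩ | ⟨rfl, rfl⟩)
      · exact ⟨rfl, i, .inl hi, rfl⟩
      · exact ⟨rfl, n, .inr rfl, rfl⟩
    · rintro ⟨rfl, i, hi | rfl, rfl⟩
      · exact .inl ⟨rfl, i, hi, rfl⟩
      · exact .inr ⟨rfl, rfl⟩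

theorem step_target_iff {N : ℕ} {c : A} {r : Term A V} :
    Step (target a b N) c r ↔
      (c = a ∧ r = par nil (branches a b N)) ∨
        (c = b ∧ ∃ i < N, r = par (act a nil) (word a b (i + 1))) := by
  simp only [target, step_par_iff, step_act_iff, step_branches_iff]
  constructor
  · rintro (⟨_, ⟨rfl, rfl⟩, rfl⟩ | ⟨_, ⟨rfl, i, hi, rfl⟩, rfl⟩)
    · exact .inl ⟨rfl, rfl⟩
    · exact .inr ⟨rfl, i, hi, rfl⟩
  · rintro (⟨rfl, rfl⟩ | ⟨rfl, i, hi, rfl⟩)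
    · exact .inl ⟨_, ⟨rfl, rfl⟩, rfl⟩
    · exact .inr ⟨_, ⟨rfl, i, hi, rfl⟩, rfl⟩

theorem step_expandedTarget_iff {N : ℕ} {c : A} {r : Term A V} :
    Step (expandedTarget a b N) c r ↔ Step (target a b N) c r := by
  rw [step_target_iff, expandedTarget, step_choice_iff, step_act_iff, step_expandedBranches_iff]

theorem closed_word (i : ℕ) : (word a b i : Term A V).Closed := by
  induction i with
  | zero => exact closed_nil.act b
  | succ i ih => exact ih.act a

theorem closed_branches (N : ℕ) : (branches a b N : Term A V).Closed := by
  induction N with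
  | zero => exact closed_nil
  | succ n ih => exact ih.choice ((closed_word _).act b)

theorem closed_target (N : ℕ) : (target a b N : Term A V).Closed :=
  (closed_nil.act a).par (closed_branches N)

theorem closed_expandedTarget (N : ℕ) : (expandedTarget a b N : Term A V).Closed := by
  refine ((closed_nil.par (closed_branches N)).act a).choice ?_
  induction N with
  | zero => exact closed_nil
  | succ n ih => exact ih.choice (((closed_nil.act a).par (closed_word _)).act b)

theorem isTrace_word (i : ℕ) :
    IsTrace (word a b i : Term A V) (List.replicate i a ++ [b]) := by
  induction i with
  | zero => exact isTrace_singleton (.act _ _)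
  | succ i ih => exact ⟨_, .act _ _, ih⟩

theorem not_isTrace_word_append (hab : a ≠ b) (i j : ℕ) :
    ¬ IsTrace (word a b j : Term A V) (List.replicate i a ++ [b, a]) := by
  induction j generalizing i with
  | zero =>
    cases i with
    | zero => simp [word, IsTrace]
    | succ i => simp [word, IsTrace, List.replicate_succ, hab]
  | succ j ih =>
    cases i with
    | zero => simp [word, IsTrace, hab.symm]
    | succ i => simpa [word, IsTrace, List.replicate_succ] using ih i

/-- The trace `aⁱba` determines `j` among the processes `a ∥ aʲb`: the last `a` has to come from
the left component. -/
theorem eq_of_isTrace_par_word (hab : a ≠ b) {i j : ℕ}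
    (h : IsTrace (par (act a nil) (word a b j) : Term A V) (List.replicate i a ++ [b, a])) :
    i = j := by
  induction j generalizing i with
  | zero =>
    cases i with
    | zero => rfl
    | succ i =>
      obtain ⟨r, hr, h⟩ := h
      rcases step_par_iff.1 hr with ⟨p', hp, rfl⟩ | ⟨q', hq, rfl⟩
      · obtain ⟨-, rfl⟩ := step_act_iff.1 hp
        exact (not_isTrace_word_append hab i 0
          ((isTrace_congr (tr_par_of_depth_left rfl) _).1 h)).elim
      · exact (hab (step_act_iff.1 hq).1).elim
  | succ j ih =>
    cases i with
    | zero =>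
      obtain ⟨r, hr, h⟩ := h
      rcases step_par_iff.1 hr with ⟨p', hp, rfl⟩ | ⟨q', hq, rfl⟩
      · exact (hab (step_act_iff.1 hp).1.symm).elim
      · exact (hab (step_act_iff.1 hq).1.symm).elim
    | succ i =>
      obtain ⟨r, hr, h⟩ := h
      rcases step_par_iff.1 hr with ⟨p', hp, rfl⟩ | ⟨q', hq, rfl⟩
      · obtain ⟨-, rfl⟩ := step_act_iff.1 hp
        exact (not_isTrace_word_append hab i (j + 1)
          ((isTrace_congr (tr_par_of_depth_left rfl) _).1 h)).elim
      · obtain ⟨-, rfl⟩ := step_act_iff.1 hq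
        rw [ih h]

theorem eq_of_isTrace_branches {N : ℕ} {c : A} {α : List A}
    (h : IsTrace (branches a b N : Term A V) (c :: α)) : c = b :=
  (step_branches_iff.1 h.choose_spec.1).1

theorem not_isTrace_branches (hab : a ≠ b) {N : ℕ} :
    ¬ IsTrace (branches a b N : Term A V) [b, b] := by
  rintro ⟨r, hr, r', hr', -⟩
  obtain ⟨-, i, -, rfl⟩ := step_branches_iff.1 hr
  exact hab (step_act_iff.1 hr').1.symm

theorem countAct_target_le [DecidableEq A] (hab : a ≠ b) (N : ℕ) :
    (target a b N : Term A V).countAct b ≤ 2 := by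
  have hw : ∀ i, (word a b i : Term A V).countAct b = 1 := by
    intro i
    induction i with
    | zero => simp [countAct, word, weight]
    | succ i ih => simpa [countAct, word, weight, hab] using ih
  have hb : (branches a b N : Term A V).countAct b ≤ 2 := by
    induction N with
    | zero => simp [countAct, branches, weight]
    | succ n ih =>
      have := hw (n + 1)
      simp only [countAct, branches, weight, if_true] at *
      omega
  simpa [countAct, target, weight, hab] using hb

/-! ### The invariant -/

/-- A term is good if, up to inert components of parallel compositions, one of its summands is the
parallel composition of a term with the traces of `a` and a term with the traces of
`∑ baⁱb`, for `1 ≤ i ≤ N`. -/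
def Good (a b : A) (N : ℕ) : Term A V → Prop
  | nil => False
  | var _ => False
  | act _ _ => False
  | choice t s => t.Good a b N ∨ s.Good a b N
  | par t s =>
    (s.depth = 0 ∧ t.Good a b N) ∨ (t.depth = 0 ∧ s.Good a b N) ∨
      (tr t = tr (act a nil : Term A V) ∧ tr s = tr (branches a b N : Term A V)) ∨
      (tr s = tr (act a nil : Term A V) ∧ tr t = tr (branches a b N : Term A V))

theorem good_target (N : ℕ) : (target a b N : Term A V).Good a b N :=
  .inr (.inr (.inl ⟨rfl, rfl⟩))

theorem not_good_expandedTarget (N : ℕ) : ¬ (expandedTarget a b N : Term A V).Good a b N := by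
  have h : ∀ n, ¬ (expandedBranches a b n : Term A V).Good a b N := by
    intro n
    induction n with
    | zero => exact id
    | succ n ih => rintro (h | h); exacts [ih h, h]
  rintro (h' | h')
  exacts [h', h N h']

/-- A good term is at least as deep as `target a b N`, hence as deep as a term below that one can
be at all. -/
theorem Good.depth_le {N : ℕ} {t : Term A V} (h : t.Good a b N) :
    (target a b N : Term A V).depth ≤ t.depth := by
  induction t with
  | nil => exact h.elim
  | var x => exact h.elim
  | act c t => exact h.elim
  | choice t s iht ihs =>
    simp only [depth, weight] at *
    rcases h with h | h
    · have := iht h; omega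
    · have := ihs h; omega
  | par t s iht ihs =>
    rcases h with ⟨-, h⟩ | ⟨-, h⟩ | ⟨h, h'⟩ | ⟨h, h'⟩
    · have := iht h; simp only [depth, weight] at *; omega
    · have := ihs h; simp only [depth, weight] at *; omega
    · simp only [depth, target, weight, weight_eq_of_tr_eq _ h, weight_eq_of_tr_eq _ h']; omega
    · simp only [depth, target, weight, weight_eq_of_tr_eq _ h, weight_eq_of_tr_eq _ h']; omega

/-- Below `target a b N`, a variable with a good instance cannot occur under a prefix or next to a
component that is not inert, because the instance already has maximal depth. -/
theorem Good.subst_of_mem_vars {N : ℕ} {σ : V → Term A V} {x : V} (hx : (σ x).Good a b N)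
    {t : Term A V} (hxt : x ∈ t.vars) (ht : Below (target a b N) (t.subst σ)) :
    (t.subst σ).Good a b N := by
  have hd := hx.depth_le
  induction t with
  | nil => exact hxt.elim
  | var y => obtain rfl : x = y := hxt; exact hx
  | act c t ih =>
    have h1 := weight_le_of_mem_vars (fun _ => 1) σ (t := t) hxt
    have h2 := ht.weight_le fun _ => 1
    simp only [subst, depth, weight] at *
    omega
  | choice t s iht ihs =>
    rcases hxt with h | h
    · exact .inl (iht h ht.of_choice.1)
    · exact .inr (ihs h ht.of_choice.2)
  | par t s iht ihs =>
    have h2 := ht.weight_le fun _ => 1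
    rcases hxt with h | h
    · have h1 := weight_le_of_mem_vars (fun _ => 1) σ h
      have h0 : (s.subst σ).depth = 0 := by simp only [subst, depth, weight] at *; omega
      exact .inl ⟨h0, iht h (ht.of_par_left h0)⟩
    · have h1 := weight_le_of_mem_vars (fun _ => 1) σ h
      have h0 : (t.subst σ).depth = 0 := by simp only [subst, depth, weight] at *; omega
      exact .inr (.inl ⟨h0, ihs h (ht.of_par_right h0)⟩)

/-- Below `target a b N`, the component next to one that performs `b` twice is inert or has the
traces of `a`; in the latter case the futures along `a` reveal the traces of the first component. -/
theorem tr_eq_of_below_par [DecidableEq A] (hab : a ≠ b) {N : ℕ} {p q : Term A V}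
    (h : Below (target a b N) (par p q)) (hp : 2 ≤ p.countAct b) (hq : q.depth ≠ 0) :
    tr q = tr (act a nil : Term A V) ∧ tr p = tr (branches a b N : Term A V) := by
  have hqb : q.countAct b = 0 := by
    have h1 := h.weight_le fun c => if c = b then 1 else 0
    have h2 : (target a b N : Term A V).countAct b ≤ 2 := countAct_target_le hab N
    simp only [countAct, weight] at *
    omega
  have key : ∀ c q', Step q c q' →
      c = a ∧ q'.depth = 0 ∧ tr p = tr (branches a b N : Term A V) := by
    intro c q' hs
    have hc : c ≠ b := by rintro rfl; have := hs.countAct_pos; omega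
    obtain ⟨r, hr, e⟩ := h c _ (.par_right hs)
    rcases step_target_iff.1 hr with ⟨rfl, rfl⟩ | ⟨hcb, -⟩
    · rw [tr_par_of_depth_left (p := nil) rfl] at e
      have h0 : q'.depth = 0 := by
        rw [depth_eq_zero_iff]
        intro d q'' hd
        obtain rfl := eq_of_isTrace_branches
          ((isTrace_congr e [d]).1 (isTrace_singleton (.par_right hd)))
        have h1 := hd.countAct_pos
        have h2 := hs.weight_le fun c => if c = d then 1 else 0
        simp only [countAct] at *
        omega
      exact ⟨rfl, h0, (tr_par_of_depth_right h0).symm.trans e⟩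
    · exact (hc hcb).elim
  obtain ⟨c, q', hs⟩ := exists_step_of_depth_pos (Nat.pos_of_ne_zero hq)
  refine ⟨Set.ext fun α => ?_, (key c q' hs).2.2⟩
  obtain ⟨rfl, -, -⟩ := key c q' hs
  change IsTrace _ _ ↔ IsTrace _ _
  rcases α with _ | ⟨d, _ | ⟨e, α⟩⟩
  · exact Iff.rfl
  · constructor
    · rintro ⟨r, hr, -⟩
      obtain ⟨rfl, -, -⟩ := key _ _ hr
      exact isTrace_singleton (.act _ _)
    · rintro ⟨r, hr, -⟩
      obtain ⟨rfl, -⟩ := step_act_iff.1 hr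
      exact isTrace_singleton hs
  · constructor
    · rintro ⟨r, hr, r', hr', -⟩
      exact (depth_eq_zero_iff.1 (key _ _ hr).2.1 _ _ hr').elim
    · rintro ⟨r, hr, r', hr', -⟩
      obtain ⟨-, rfl⟩ := step_act_iff.1 hr
      exact (step_nil_iff.1 hr').elim

/-! ### Probing a variable with a long process -/

/-- The process `bⁿ`. -/
def power (b : A) : ℕ → Term A V
  | 0 => nil
  | n + 1 => act b (power b n)

theorem closed_power (n : ℕ) : (power b n : Term A V).Closed := by
  induction n with
  | zero => exact closed_nil
  | succ n ih => exact ih.act b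

theorem depth_power (n : ℕ) : (power b n : Term A V).depth = n := by
  induction n with
  | zero => rfl
  | succ n ih => simp only [depth, power, weight] at *; omega

section Probe

variable [DecidableEq A] {N n : ℕ} {σ : V → Term A V} {x : V}

theorem notMem_vars_of_countAct_lt (hx : 2 ≤ (σ x).countAct b) {t : Term A V}
    (h : (t.subst σ).countAct b < 2) : x ∉ t.vars := fun hxt => by
  have := weight_le_of_mem_vars (fun c => if c = b then 1 else 0) σ hxt
  simp only [countAct] at *
  omega

theorem notMem_vars_of_depth_eq_zero (hx : 2 ≤ (σ x).countAct b) {t : Term A V}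
    (h : (t.subst σ).depth = 0) : x ∉ t.vars := by
  have := countAct_le_depth b (t.subst σ)
  exact notMem_vars_of_countAct_lt hx (by omega)

variable [DecidableEq V]

/-- The case of `good_of_step_probe` in which a component of a parallel composition moves. -/
theorem good_or_of_step_probe_par (hab : a ≠ b) (hx : 2 ≤ (σ x).countAct b) {v w v' : Term A V}
    (hn : ((par v w).subst σ).depth ≤ n) (hB : Below (target a b N) ((par v w).subst σ))
    (hs : Step (v.subst (Function.update σ x (power b (n + 1)))) b v')
    (hd : v'.depth + (w.subst (Function.update σ x (power b (n + 1)))).depth = n + 1)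
    (ih : Below (target a b N) (v.subst σ) → v'.depth = n + 1 → (v.subst σ).Good a b N) :
    ((w.subst σ).depth = 0 ∧ (v.subst σ).Good a b N) ∨
      (tr (w.subst σ) = tr (act a nil : Term A V) ∧
        tr (v.subst σ) = tr (branches a b N : Term A V)) := by
  by_cases hw : (w.subst σ).depth = 0
  · rw [subst_update_of_notMem _ _ (notMem_vars_of_depth_eq_zero hx hw), hw] at hd
    exact .inl ⟨hw, ih (hB.of_par_left hw) hd⟩
  · have hle := hB.weight_le fun c => if c = b then 1 else 0
    have h2 : (target a b N : Term A V).countAct b ≤ 2 := countAct_target_le hab N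
    by_cases hxv : x ∈ v.vars
    · have h1 := weight_le_of_mem_vars (fun c => if c = b then 1 else 0) σ hxv
      refine .inr (tr_eq_of_below_par hab hB ?_ hw)
      simp only [countAct] at *
      omega
    · rw [subst_update_of_notMem _ _ hxv] at hs
      -- The variable cannot occur in `w` either: `w` would perform `b` twice, and `v` does it too.
      have hxw : x ∉ w.vars := by
        have h1 := hs.countAct_pos
        apply notMem_vars_of_countAct_lt hx
        simp only [subst, countAct, weight] at *
        omega
      rw [subst_update_of_notMem _ _ hxw] at hd
      have h1 := hs.weight_le fun _ => 1
      simp only [subst, depth, weight] at *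
      omega

/-- Let `σ x` perform `b` twice, and replace it by `bⁿ⁺¹` for a large `n`. A transition to a term
of depth `n + 1` then has to come from a parallel composition of a component containing `x` and
another one that is not inert: below `target a b N`, this is the good summand. -/
theorem good_of_step_probe (hab : a ≠ b) (hx : 2 ≤ (σ x).countAct b) {t r : Term A V}
    (hn : (t.subst σ).depth ≤ n) (hB : Below (target a b N) (t.subst σ))
    (hs : Step (t.subst (Function.update σ x (power b (n + 1)))) b r) (hd : r.depth = n + 1) :
    (t.subst σ).Good a b N := by
  induction t generalizing r with
  | nil => exact (step_nil_iff.1 hs).elim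
  | var y =>
    by_cases hy : y = x
    · subst hy
      simp only [subst, Function.update_self, power, step_act_iff, true_and] at hs
      rw [hs, depth_power] at hd
      omega
    · simp only [subst, Function.update_of_ne hy] at hs hn
      have := hs.weight_le fun _ => 1
      simp only [depth] at *
      omega
  | act c t =>
    obtain ⟨rfl, rfl⟩ := step_act_iff.1 hs
    have h1 := hB.weight_le fun c => if c = b then 1 else 0
    have h2 : (target a b N : Term A V).countAct b ≤ 2 := countAct_target_le hab N
    -- Otherwise the instance of `t` would allow three occurrences of `b`.
    have hxt : x ∉ t.vars := by
      apply notMem_vars_of_countAct_lt hx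
      simp only [subst, countAct, weight, if_true] at *
      omega
    rw [subst_update_of_notMem _ _ hxt] at hd
    simp only [subst, depth, weight] at *
    omega
  | choice t s iht ihs =>
    have hn' : (t.subst σ).depth ≤ n ∧ (s.subst σ).depth ≤ n := by
      simp only [subst, depth, weight] at *; omega
    rcases step_choice_iff.1 hs with hs | hs
    · exact .inl (iht hn'.1 hB.of_choice.1 hs hd)
    · exact .inr (ihs hn'.2 hB.of_choice.2 hs hd)
  | par t s iht ihs =>
    have hn' : (t.subst σ).depth ≤ n ∧ (s.subst σ).depth ≤ n := by
      simp only [subst, depth, weight] at *; omega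
    rcases step_par_iff.1 hs with ⟨t', ht, rfl⟩ | ⟨s', hs', rfl⟩
    · rcases good_or_of_step_probe_par hab hx hn hB ht hd
        (fun h h' => iht hn'.1 h ht h') with h | h
      · exact .inl h
      · exact .inr (.inr (.inr h))
    · have hn2 : ((par s t).subst σ).depth ≤ n := by
        simp only [subst, depth, weight] at *; omega
      have hd2 : s'.depth + (t.subst (Function.update σ x (power b (n + 1)))).depth = n + 1 := by
        simp only [depth, weight] at *; omega
      rcases good_or_of_step_probe_par hab hx hn2 hB.par_comm hs' hd2
        (fun h h' => ihs hn'.2 h hs' h') with h | h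
      · exact .inr (.inl h)
      · exact .inr (.inr (.inl h))

end Probe

/-! ### Finding the variable to probe -/

/-- The number of prefixes in a term. -/
def prefixCount : Term A V → ℕ
  | nil => 0
  | var _ => 0
  | act _ t => t.prefixCount + 1
  | choice t s => t.prefixCount + s.prefixCount
  | par t s => t.prefixCount + s.prefixCount

/-- The indices of the processes `baⁱb` that a term can start to perform. -/
def branchIndices (a b : A) (p : Term A V) : Set ℕ :=
  {i | IsTrace p (b :: (List.replicate i a ++ [b]))}

theorem branchIndices_congr {p q : Term A V} (h : tr p = tr q) :
    branchIndices a b p = branchIndices a b q :=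
  Set.ext fun _ => isTrace_congr h _

theorem countAct_of_mem_branchIndices [DecidableEq A] {i : ℕ} {p : Term A V}
    (h : i ∈ branchIndices a b p) : 2 ≤ p.countAct b := by
  have := IsTrace.sum_le (fun c => if c = b then 1 else 0) h
  simp only [List.map_cons, List.map_append, List.sum_cons, List.sum_append, if_true,
    List.map_nil, List.sum_nil] at this
  simp only [countAct]
  omega

theorem le_encard_branchIndices_branches (N : ℕ) :
    (N : ℕ∞) ≤ (branchIndices a b (branches a b N : Term A V)).encard := by
  have h : ((Finset.Icc 1 N : Finset ℕ) : Set ℕ) ⊆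
      branchIndices a b (branches a b N : Term A V) := by
    intro i hi
    simp only [Finset.coe_Icc, Set.mem_Icc] at hi
    obtain ⟨j, rfl⟩ : ∃ j, i = j + 1 := ⟨i - 1, by omega⟩
    exact ⟨_, step_branches_iff.2 ⟨rfl, j, by omega, rfl⟩, isTrace_word _⟩
  have := Set.encard_le_encard h
  rw [Set.encard_coe_eq_coe_finsetCard, Nat.card_Icc] at this
  simpa using this

variable [DecidableEq A] [DecidableEq V]

/-- `x` is a summand of `t`, up to components that are inert under `σ`, with an instance that
performs `b` twice; `k` is the depth that the context of `x` adds. The summand is recognised by its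
effect on transitions when the instance is replaced by `bⁿ⁺¹`. -/
def Probes (b : A) (σ : V → Term A V) (k : ℕ) (t : Term A V) (x : V) : Prop :=
  2 ≤ (σ x).countAct b ∧ ∀ n, ∃ r,
    Step (t.subst (Function.update σ x (power b (n + 1)))) b r ∧ r.depth = n + k

theorem Probes.choice_left {σ : V → Term A V} {k : ℕ} {t s : Term A V} {x : V}
    (h : Probes b σ k t x) : Probes b σ k (choice t s) x :=
  ⟨h.1, fun n => let ⟨r, hr, hd⟩ := h.2 n; ⟨r, .choice_left hr, hd⟩⟩

theorem Probes.choice_right {σ : V → Term A V} {k : ℕ} {t s : Term A V} {x : V}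
    (h : Probes b σ k s x) : Probes b σ k (choice t s) x :=
  ⟨h.1, fun n => let ⟨r, hr, hd⟩ := h.2 n; ⟨r, .choice_right hr, hd⟩⟩

theorem Probes.par_left {σ : V → Term A V} {k l : ℕ} {t s : Term A V} {x : V}
    (h : Probes b σ k t x) (hs : (s.subst σ).depth = l) (hsb : (s.subst σ).countAct b < 2) :
    Probes b σ (k + l) (par t s) x := by
  refine ⟨h.1, fun n => ?_⟩
  obtain ⟨r, hr, hd⟩ := h.2 n
  refine ⟨_, .par_left hr, ?_⟩
  rw [subst_update_of_notMem _ _ (notMem_vars_of_countAct_lt h.1 hsb)]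
  simp only [depth, weight] at *
  omega

theorem Probes.par_right {σ : V → Term A V} {k l : ℕ} {t s : Term A V} {x : V}
    (h : Probes b σ k s x) (ht : (t.subst σ).depth = l) (htb : (t.subst σ).countAct b < 2) :
    Probes b σ (k + l) (par t s) x := by
  refine ⟨h.1, fun n => ?_⟩
  obtain ⟨r, hr, hd⟩ := h.2 n
  refine ⟨_, .par_right hr, ?_⟩
  rw [subst_update_of_notMem _ _ (notMem_vars_of_countAct_lt h.1 htb)]
  simp only [depth, weight] at *
  omega

/-- If all first actions are `b`, the trace `bb` is impossible, and each transition starts at most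
one `baⁱb`, then every summand that is not a variable is a prefix and contributes at most one
index. -/
theorem encard_branchIndices_le (σ : V → Term A V) (t : Term A V)
    (hb : ∀ c r, Step (t.subst σ) c r → c = b) (hbb : ¬ IsTrace (t.subst σ) [b, b])
    (hu : ∀ r, Step (t.subst σ) b r → ∀ i j, IsTrace r (List.replicate i a ++ [b]) →
      IsTrace r (List.replicate j a ++ [b]) → i = j)
    (hx : ∀ x, ¬ Probes b σ 0 t x) :
    (branchIndices a b (t.subst σ)).encard ≤ t.prefixCount := by
  induction t with
  | nil =>
    have : branchIndices a b (nil : Term A V) = ∅ := by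
      ext i; simp [branchIndices, IsTrace]
    simp [subst, this]
  | var x =>
    have : branchIndices a b (σ x) = ∅ := by
      refine Set.eq_empty_of_forall_notMem fun i hi => hx x ⟨countAct_of_mem_branchIndices hi, ?_⟩
      intro n
      refine ⟨power b n, ?_, depth_power n⟩
      simp only [subst, Function.update_self]
      exact .act _ _
    simp [subst, this]
  | act c t ih =>
    have : (branchIndices a b ((act c t).subst σ)).encard ≤ 1 := by
      rw [Set.encard_le_one_iff]
      rintro i j ⟨r, hr, hi⟩ ⟨r', hr', hj⟩
      obtain ⟨rfl, rfl⟩ := step_act_iff.1 hr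
      obtain ⟨-, rfl⟩ := step_act_iff.1 hr'
      exact hu _ hr i j hi hj
    refine this.trans ?_
    simp [prefixCount]
  | choice t s iht ihs =>
    have h1 := iht (fun c r h => hb c r (.choice_left h)) (fun h => hbb h.choice_left)
      (fun r h => hu r (.choice_left h)) (fun x h => hx x h.choice_left)
    have h2 := ihs (fun c r h => hb c r (.choice_right h)) (fun h => hbb h.choice_right)
      (fun r h => hu r (.choice_right h)) (fun x h => hx x h.choice_right)
    have hsub : branchIndices a b ((choice t s).subst σ) ⊆
        branchIndices a b (t.subst σ) ∪ branchIndices a b (s.subst σ) := by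
      rintro i ⟨r, hr, hi⟩
      rcases step_choice_iff.1 hr with h | h
      · exact .inl ⟨r, h, hi⟩
      · exact .inr ⟨r, h, hi⟩
    refine (Set.encard_le_encard hsub).trans ((Set.encard_union_le _ _).trans ?_)
    simpa [prefixCount] using add_le_add h1 h2
  | par t s iht ihs =>
    by_cases hs : (s.subst σ).depth = 0
    · have hsb := countAct_le_depth b (s.subst σ)
      have h1 := iht (fun c r h => hb c _ (.par_left h))
        (fun h => hbb ((isTrace_congr (tr_par_of_depth_right hs) _).2 h))
        (fun r h i j hi hj => hu _ (.par_left h) i j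
          ((isTrace_congr (tr_par_of_depth_right hs) _).2 hi)
          ((isTrace_congr (tr_par_of_depth_right hs) _).2 hj))
        (fun x h => hx x (h.par_left hs (by omega)))
      simp only [subst]
      rw [branchIndices_congr (tr_par_of_depth_right hs)]
      refine h1.trans ?_
      simp [prefixCount]
    by_cases ht : (t.subst σ).depth = 0
    · have htb := countAct_le_depth b (t.subst σ)
      have h1 := ihs (fun c r h => hb c _ (.par_right h))
        (fun h => hbb ((isTrace_congr (tr_par_of_depth_left ht) _).2 h))
        (fun r h i j hi hj => hu _ (.par_right h) i j
          ((isTrace_congr (tr_par_of_depth_left ht) _).2 hi)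
          ((isTrace_congr (tr_par_of_depth_left ht) _).2 hj))
        (fun x h => hx x (h.par_right ht (by omega)))
      simp only [subst]
      rw [branchIndices_congr (tr_par_of_depth_left ht)]
      refine h1.trans ?_
      simp [prefixCount]
    obtain ⟨c, t', ht'⟩ := exists_step_of_depth_pos (Nat.pos_of_ne_zero ht)
    obtain ⟨d, s', hs'⟩ := exists_step_of_depth_pos (Nat.pos_of_ne_zero hs)
    obtain rfl := hb c _ (.par_left ht')
    obtain rfl := hb d _ (.par_right hs')
    exact (hbb ⟨_, .par_left ht', isTrace_singleton (.par_right hs')⟩).elim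

theorem exists_probes_of_tr_eq (hab : a ≠ b) {N : ℕ} {σ : V → Term A V} {p t : Term A V}
    (hp : tr p = tr (act a nil : Term A V))
    (ht : tr (t.subst σ) = tr (branches a b N : Term A V))
    (hB : Below (target a b N) (par p (t.subst σ))) (hN : t.prefixCount < N) :
    ∃ x, Probes b σ 0 t x := by
  by_contra! hx
  obtain ⟨p', hp', -⟩ := (isTrace_congr hp [a]).2 (isTrace_singleton (.act _ _))
  have h := encard_branchIndices_le (a := a) σ t
    (fun c r hr => eq_of_isTrace_branches ((isTrace_congr ht [c]).1 (isTrace_singleton hr)))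
    (fun h => not_isTrace_branches hab ((isTrace_congr ht _).1 h)) ?_ hx
  · rw [branchIndices_congr ht] at h
    have := (le_encard_branchIndices_branches N).trans h
    rw [Nat.cast_le] at this
    omega
  · intro r hr i j hi hj
    obtain ⟨q, hq, e⟩ := hB b _ (.par_right hr)
    rcases step_target_iff.1 hq with ⟨h, -⟩ | ⟨-, k, -, rfl⟩
    · exact (hab h.symm).elim
    · have key : ∀ i, IsTrace r (List.replicate i a ++ [b]) → i = k + 1 := fun i hi =>
        eq_of_isTrace_par_word hab ((isTrace_congr e _).1
          (by simpa using hi.par_append_singleton hp'))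
      rw [key i hi, key j hj]

/-- With fewer than `N` prefixes, the summand of `t` with a good instance is a variable, or a
parallel composition in which a variable contributes to the second component. -/
theorem Good.exists_probes (hab : a ≠ b) {N : ℕ} {σ : V → Term A V} {t : Term A V}
    (h : (t.subst σ).Good a b N) (hB : Below (target a b N) (t.subst σ))
    (hN : t.prefixCount < N) :
    (∃ x ∈ t.vars, (σ x).Good a b N) ∨ ∃ x, Probes b σ 1 t x := by
  induction t with
  | nil => exact h.elim
  | var x => exact .inl ⟨x, rfl, h⟩
  | act c t => exact h.elim
  | choice t s iht ihs =>
    simp only [prefixCount] at hN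
    rcases h with h | h
    · rcases iht h hB.of_choice.1 (by omega) with ⟨x, hx, hg⟩ | ⟨x, hx⟩
      · exact .inl ⟨x, .inl hx, hg⟩
      · exact .inr ⟨x, hx.choice_left⟩
    · rcases ihs h hB.of_choice.2 (by omega) with ⟨x, hx, hg⟩ | ⟨x, hx⟩
      · exact .inl ⟨x, .inr hx, hg⟩
      · exact .inr ⟨x, hx.choice_right⟩
  | par t s iht ihs =>
    simp only [prefixCount] at hN
    have hda : (act a nil : Term A V).depth = 1 := rfl
    have hca : (act a nil : Term A V).countAct b = 0 := by simp [countAct, weight, hab]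
    rcases h with ⟨h0, h⟩ | ⟨h0, h⟩ | ⟨h, h'⟩ | ⟨h, h'⟩
    · rcases iht h (hB.of_par_left h0) (by omega) with ⟨x, hx, hg⟩ | ⟨x, hx⟩
      · exact .inl ⟨x, .inl hx, hg⟩
      · have := countAct_le_depth b (s.subst σ)
        exact .inr ⟨x, hx.par_left h0 (by omega)⟩
    · rcases ihs h (hB.of_par_right h0) (by omega) with ⟨x, hx, hg⟩ | ⟨x, hx⟩
      · exact .inl ⟨x, .inr hx, hg⟩
      · have := countAct_le_depth b (t.subst σ)
        exact .inr ⟨x, hx.par_right h0 (by omega)⟩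
    · obtain ⟨x, hx⟩ := exists_probes_of_tr_eq hab h h' hB (by omega)
      have h1 : (t.subst σ).countAct b = 0 := (weight_eq_of_tr_eq _ h).trans hca
      exact .inr ⟨x, hx.par_right ((weight_eq_of_tr_eq _ h).trans hda) (by omega)⟩
    · obtain ⟨x, hx⟩ := exists_probes_of_tr_eq hab h h' hB.par_comm (by omega)
      have h1 : (s.subst σ).countAct b = 0 := (weight_eq_of_tr_eq _ h).trans hca
      exact .inr ⟨x, hx.par_left ((weight_eq_of_tr_eq _ h).trans hda) (by omega)⟩

end Term

/-! ### Soundness and preservation of the invariant -/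

variable {A : Type u} {V : Type v}

open Term

theorem Proc.mem_traces_iff (p : Proc A V) (α : List A) : α ∈ p.traces ↔ IsTrace p.1 α := by
  induction α generalizing p with
  | nil => exact ⟨fun _ => trivial, fun _ => ⟨p, rfl⟩⟩
  | cons c α ih =>
    constructor
    · rintro ⟨q, r, hr, h⟩
      exact ⟨r.1, hr, (ih r).1 ⟨q, h⟩⟩
    · rintro ⟨r, hr, h⟩
      obtain ⟨q, hq⟩ := (ih ⟨r, hr.closed p.2⟩).2 h
      exact ⟨q, ⟨r, hr.closed p.2⟩, hr, hq⟩

theorem Proc.traces_eq_tr (p : Proc A V) : p.traces = tr p.1 := Set.ext p.mem_traces_iff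

theorem Proc.PFEquiv.tr_eq {p q : Proc A V} (h : PFEquiv p q) : tr p.1 = tr q.1 := by
  obtain ⟨r, hr, e⟩ : (([], p.traces) : List A × Set (List A)) ∈ q.possibleFutures :=
    h ▸ ⟨p, rfl, rfl⟩
  obtain rfl : q = r := hr
  rw [← traces_eq_tr, ← traces_eq_tr]
  exact e

theorem Proc.PFEquiv.below {p q : Proc A V} (h : PFEquiv p q) : Below q.1 p.1 := by
  intro c p' hp
  obtain ⟨r, ⟨r', hr, e⟩, e'⟩ :
      (([c], traces ⟨p', hp.closed p.2⟩) : List A × Set (List A)) ∈ q.possibleFutures :=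
    h ▸ ⟨_, ⟨⟨p', hp.closed p.2⟩, hp, rfl⟩, rfl⟩
  obtain rfl : r' = r := e
  refine ⟨r'.1, hr, ?_⟩
  simpa only [traces_eq_tr] using e'

theorem Proc.bisimilar_of_step_iff {p q : Proc A V} (h : ∀ c r, p.Step c r ↔ q.Step c r) :
    Bisimilar p q := by
  refine ⟨fun r s => r = s ∨ (r = p ∧ s = q) ∨ (r = q ∧ s = p), ?_, ?_, .inr (.inl ⟨rfl, rfl⟩)⟩
  · rintro r s (rfl | ⟨rfl, rfl⟩ | ⟨rfl, rfl⟩)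
    · exact .inl rfl
    · exact .inr (.inr ⟨rfl, rfl⟩)
    · exact .inr (.inl ⟨rfl, rfl⟩)
  · rintro r s (rfl | ⟨rfl, rfl⟩ | ⟨rfl, rfl⟩) c r' hr
    · exact ⟨r', hr, .inl rfl⟩
    · exact ⟨r', (h c r').1 hr, .inl rfl⟩
    · exact ⟨r', (h c r').2 hr, .inl rfl⟩

theorem Derivable.soundEquation {R : Proc A V → Proc A V → Prop} (hR : Proc.IsCongruence R)
    {E : AxiomSystem A V} (hE : Sound R E) {t s : Term A V} (h : Derivable E t s) :
    SoundEquation R t s := by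
  induction h with
  | ax h => exact hE _ _ h
  | refl t => exact fun σ hσ => hR.equivalence.refl _
  | symm _ ih => exact fun σ hσ => hR.equivalence.symm (ih σ hσ)
  | trans _ _ ih ih' => exact fun σ hσ => hR.equivalence.trans (ih σ hσ) (ih' σ hσ)
  | subst τ _ ih =>
    intro σ hσ
    simpa only [subst_subst] using
      ih (fun x => (τ x).subst σ) fun x => closed_subst hσ (τ x)
  | act a _ ih => exact fun σ hσ => hR.act a (ih σ hσ)
  | choice _ _ ih ih' => exact fun σ hσ => hR.choice (ih σ hσ) (ih' σ hσ)
  | par _ _ ih ih' => exact fun σ hσ => hR.par (ih σ hσ) (ih' σ hσ)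

variable {a b : A}

/-- A sound equation whose left-hand side has fewer than `N` prefixes preserves goodness below
`target a b N`, from left to right. -/
theorem SoundEquation.good (hab : a ≠ b) {N : ℕ} {t s : Term A V}
    (h : SoundEquation Proc.PFEquiv t s) (hN : t.prefixCount < N) {σ : V → Term A V}
    (hσ : ∀ x, (σ x).Closed) (hB : Below (target a b N) (t.subst σ))
    (hg : (t.subst σ).Good a b N) : (s.subst σ).Good a b N := by
  classical
  have hB' : Below (target a b N) (s.subst σ) := hB.trans (Proc.PFEquiv.below (h σ hσ).symm)
  have hclosed : ∀ x n y, (Function.update σ x (power b n) y).Closed := by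
    intro x n y
    by_cases hy : y = x
    · subst hy; simpa using closed_power n
    · simpa [hy] using hσ y
  rcases hg.exists_probes hab hB hN with ⟨x, hx, hxg⟩ | ⟨x, hx⟩
  · refine hxg.subst_of_mem_vars ?_ hB'
    -- A variable missing on the right would not affect the depth there.
    by_contra hxs
    have h1 := weight_eq_of_tr_eq (fun _ => 1)
      (h _ (hclosed x ((s.subst σ).depth + 1))).tr_eq
    have h2 := weight_le_of_mem_vars (fun _ => 1)
      (Function.update σ x (power b ((s.subst σ).depth + 1))) hx
    rw [Function.update_self] at h2
    simp only [subst_update_of_notMem _ _ hxs] at h1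
    have h3 := depth_power (b := b) (V := V) ((s.subst σ).depth + 1)
    simp only [depth] at *
    omega
  · obtain ⟨r, hr, hd⟩ := hx.2 (s.subst σ).depth
    obtain ⟨r', hr', e⟩ := (h _ (hclosed x ((s.subst σ).depth + 1))).below _ _ hr
    exact good_of_step_probe hab hx.1 le_rfl hB' hr' ((weight_eq_of_tr_eq _ e).symm.trans hd)

theorem Derivable.good_iff (hab : a ≠ b) {R : Proc A V → Proc A V → Prop}
    (hR : Proc.IsCongruence R) (hRPF : ∀ p q : Proc A V, R p q → Proc.PFEquiv p q)
    {E : AxiomSystem A V} (hE : Sound R E) {N : ℕ}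
    (hN : ∀ e ∈ E, e.1.prefixCount < N ∧ e.2.prefixCount < N) {t s : Term A V}
    (h : Derivable E t s) {σ : V → Term A V} (hσ : ∀ x, (σ x).Closed)
    (hB : Below (target a b N) (t.subst σ)) :
    (t.subst σ).Good a b N ↔ (s.subst σ).Good a b N := by
  have sound : ∀ {t s : Term A V}, Derivable E t s → SoundEquation Proc.PFEquiv t s :=
    fun h σ hσ => hRPF _ _ (h.soundEquation hR hE σ hσ)
  have trEq : ∀ {t s : Term A V}, Derivable E t s → ∀ {σ : V → Term A V},
      (∀ x, (σ x).Closed) → tr (t.subst σ) = tr (s.subst σ) :=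
    fun h _ hσ => (sound h _ hσ).tr_eq
  have depthEq : ∀ {t s : Term A V}, Derivable E t s → ∀ {σ : V → Term A V},
      (∀ x, (σ x).Closed) → (t.subst σ).depth = (s.subst σ).depth :=
    fun h _ hσ => weight_eq_of_tr_eq _ (trEq h hσ)
  have transfer : ∀ {t s : Term A V}, Derivable E t s → ∀ {σ : V → Term A V},
      (∀ x, (σ x).Closed) → Below (target a b N) (t.subst σ) →
      Below (target a b N) (s.subst σ) :=
    fun h _ hσ hB => hB.trans (Proc.PFEquiv.below (sound h _ hσ).symm)
  induction h generalizing σ with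
  | ax h =>
    exact ⟨(sound (.ax h)).good hab (hN _ h).1 hσ hB,
      (sound (.symm (.ax h))).good hab (hN _ h).2 hσ (transfer (.ax h) hσ hB)⟩
  | refl t => exact Iff.rfl
  | symm h ih => exact (ih hσ (transfer h.symm hσ hB)).symm
  | trans h h' ih ih' => exact (ih hσ hB).trans (ih' hσ (transfer h hσ hB))
  | subst τ h ih =>
    rw [subst_subst] at hB ⊢
    rw [subst_subst]
    exact ih (fun x => closed_subst hσ (τ x)) hB
  | act c h ih => exact Iff.rfl
  | choice h h' ih ih' => exact or_congr (ih hσ hB.of_choice.1) (ih' hσ hB.of_choice.2)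
  | par h h' ih ih' =>
    simp only [Term.subst, Good]
    rw [← depthEq h hσ, ← depthEq h' hσ, ← trEq h hσ, ← trEq h' hσ]
    exact or_congr (and_congr_right fun h0 => ih hσ (hB.of_par_left h0))
      (or_congr (and_congr_right fun h0 => ih' hσ (hB.of_par_right h0)) Iff.rfl)

end BCCSPPar

theorem mainTheorem2 {A : Type*} [Finite A] (hA : 2 ≤ Nat.card A)
    {V : Type*} [Countable V] [Infinite V]
    (R : BCCSPPar.Proc A V → BCCSPPar.Proc A V → Prop)
    (hR : BCCSPPar.Proc.IsCongruence R)
    (hBR : ∀ p q : BCCSPPar.Proc A V, BCCSPPar.Proc.Bisimilar p q → R p q)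
    (hRPF : ∀ p q : BCCSPPar.Proc A V, R p q → BCCSPPar.Proc.PFEquiv p q) :
    ¬ BCCSPPar.HasFiniteGroundCompleteAxiomatisation R := by
  open BCCSPPar Term in
  rintro ⟨E, hfin, hE, hcomplete⟩
  obtain ⟨a, b, hab⟩ : ∃ a b : A, a ≠ b :=
    have := Finite.one_lt_card_iff_nontrivial.1 (show 1 < Nat.card A by omega)
    exists_pair_ne A
  obtain ⟨M, hM⟩ := (hfin.image fun e => max e.1.prefixCount e.2.prefixCount).bddAbove
  have hN : ∀ e ∈ E, e.1.prefixCount < M + 1 ∧ e.2.prefixCount < M + 1 := by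
    intro e he
    have : max e.1.prefixCount e.2.prefixCount ≤ M := hM (Set.mem_image_of_mem _ he)
    omega
  let p : Proc A V := ⟨target a b (M + 1), closed_target _⟩
  let q : Proc A V := ⟨expandedTarget a b (M + 1), closed_expandedTarget _⟩
  have hd : Derivable E p.1 q.1 := hcomplete p q (hBR p q
    (Proc.bisimilar_of_step_iff fun c r => step_expandedTarget_iff.symm))
  have h := hd.good_iff hab hR hRPF hE hN (σ := fun _ => nil) (fun _ => closed_nil)
    (by rw [p.2.subst_eq _]; exact Below.refl _)
  rw [p.2.subst_eq _, q.2.subst_eq _] at h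
  exact not_good_expandedTarget _ (h.1 (good_target _))
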